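/- Let $n\ge 0$, let $B_{n+1}^+$ be the braid semigroup (with identity) presented by generators $a_1,\dots,a_n$ and relations $a_{i+1}a_ia_{i+1}=a_ia_{i+1}a_i$ ($1\le i\le n-1$) and $a_ia_j=a_ja_i$ ($i-j\ge 2$), and let $k$ be a field. Order words in $a_1<\dots<a_n$ by the deg-lex order (first by length, then lexicographically). Write $a_{ij}=a_ia_{i-1}\cdots a_j$ for $i\ge j$ and $a_{i,i+1}=1$ (the empty word). Let $S\subset k\langle a_1,\dots,a_n\rangle$ be the set of all polynomials $u-v$, where $u=v$ runs through the relations $$a_{i+1}a_i\,V\,W\,a_{i+1,j}=a_ia_{i+1}a_i\,V\,a_{ij}\,W'\qquad(1\le i\le n-1,\ 1\le j\le i+1),$$ $$a_sa_k=a_ka_s\qquad(1\le k,\ s\le n,\ s-k\ge 2).$$ Here $V$ is any word in $a_1,\dots,a_{i-1}$; $W$ is any word in $a_j,\dots,a_i$ (the empty word if $j=i+1$) that is empty or begins with $a_i$; and $W'$ is obtained from $W$ by raising every index by one. Then $S$ is a Gröbner–Shirshov basis of $B_{n+1}^+$: it consists of monic polynomials and generates the same two-sided ideal as the differences of the two sides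 of the defining relations, and every composition $(f,g)_w$ (of intersection or of including) of elements of $S$ is trivial modulo $(S,w)$, i.e. is a $k$-linear combination of polynomials $atb$ with $t\in S$, $a,b$ words, and leading word smaller than $w$. Consequently, call a word reduced if it contains no leading word of an element of $S$ as a subword. Every element of $B_{n+1}^+$ is represented by exactly one reduced word, its normal form. Every sequence of eliminations of leading words of elements of $S$, applied to a word, terminates; the normal form is reached from the word by such eliminations and is a computable function of it; and two words represent the same element of $B_{n+1}^+$ if and only if their normal forms coincide. In particular the word problem of $B_{n+1}^+$ is decidable. -/

import Mathlib

/-! ### Gröbner–Shirshov bases in the free associative algebra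

The free associative algebra `k⟨X⟩` is the monoid algebra of the free monoid `X*`. Words over the
linearly ordered alphabet `X` are compared by the deg-lex order. -/

namespace GSBasis

variable {X : Type*}

/-- The free associative algebra `k⟨X⟩`. -/
abbrev FreeAlg (k X : Type*) [Field k] : Type _ := MonoidAlgebra k (FreeMonoid X)

/-- A word, as an element of `k⟨X⟩`. -/
noncomputable def word (k : Type*) [Field k] (u : FreeMonoid X) : FreeAlg k X :=
  MonoidAlgebra.of k (FreeMonoid X) u

/-- The deg-lex order `u < v`: compare lengths first, then lexicographically. -/
def DegLex [LinearOrder X] (u v : FreeMonoid X) : Prop :=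
  List.Shortlex (· < ·) u.toList v.toList

variable {k : Type*} [Field k]

/-- `w` is the leading word of `f` (no `w` is one when `f = 0`). -/
def IsLeadingWord [LinearOrder X] (f : FreeAlg k X) (w : FreeMonoid X) : Prop :=
  w ∈ f.coeff.support ∧ ∀ v ∈ f.coeff.support, v ≠ w → DegLex v w

/-- `f` is monic: it has a leading word, with coefficient `1`. -/
def IsMonic [LinearOrder X] (f : FreeAlg k X) : Prop :=
  ∃ w, IsLeadingWord f w ∧ f.coeff w = 1

/-- `IsComposition f g w h`: `h` is a composition `(f, g)_w` relative to the ambiguity `w`. -/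
inductive IsComposition [LinearOrder X] (f g : FreeAlg k X) :
    FreeMonoid X → FreeAlg k X → Prop
  /-- Composition of intersection: `w = f̄ b = a ḡ` with `deg f̄ + deg ḡ > deg w`. -/
  | intersection (lf lg a b : FreeMonoid X) (hf : IsLeadingWord f lf) (hg : IsLeadingWord g lg)
      (hw : lf * b = a * lg) (hdeg : (lf * b).length < lf.length + lg.length) :
      IsComposition f g (lf * b) (f * word k b - word k a * g)
  /-- Composition of including: `w = f̄ = a ḡ b`. -/
  | including (lf lg a b : FreeMonoid X) (hf : IsLeadingWord f lf) (hg : IsLeadingWord g lg)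
      (hw : lf = a * lg * b) :
      IsComposition f g lf (f - word k a * g * word k b)

/-- `h ≡ 0 mod (S, w)`: `h` is a linear combination of elements `a t b` with `t ∈ S` and words
`a`, `b`, such that the leading word of each `a t b` is smaller than `w`. -/
def IsTrivialMod [LinearOrder X] (S : Set (FreeAlg k X)) (w : FreeMonoid X)
    (h : FreeAlg k X) : Prop :=
  h ∈ Submodule.span k
    {p : FreeAlg k X | ∃ t ∈ S, ∃ a b : FreeMonoid X, p = word k a * t * word k b ∧
      ∃ v, IsLeadingWord p v ∧ DegLex v w}

/-- `S` is a Gröbner–Shirshov basis: it consists of monic polynomials, and every composition of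
elements of `S` is trivial relative to `S`. -/
def IsGSBasis [LinearOrder X] (S : Set (FreeAlg k X)) : Prop :=
  (∀ f ∈ S, IsMonic f) ∧
    ∀ f ∈ S, ∀ g ∈ S, ∀ w h, IsComposition f g w h → IsTrivialMod S w h

/-- The polynomials `u - v`, for the relations `u = v` in `rels`. -/
def relPolys (k : Type*) [Field k] (rels : FreeMonoid X → FreeMonoid X → Prop) :
    Set (FreeAlg k X) :=
  {p | ∃ u v, rels u v ∧ p = word k u - word k v}

/-- `S` is a Gröbner–Shirshov basis of the semigroup (with `1`) presented by the generators `X`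
and the relations `rels`: it is a Gröbner–Shirshov basis, and it generates the same
ideal of `k⟨X⟩` as the defining relations. -/
def IsGSBasisOf [LinearOrder X] (S : Set (FreeAlg k X))
    (rels : FreeMonoid X → FreeMonoid X → Prop) : Prop :=
  IsGSBasis S ∧ TwoSidedIdeal.span S = TwoSidedIdeal.span (relPolys k rels)

/-- `u` is `S`-reduced: no leading word of an element of `S` is a subword of `u`. -/
def IsReduced [LinearOrder X] (S : Set (FreeAlg k X)) (u : FreeMonoid X) : Prop :=
  ∀ f ∈ S, ∀ w, IsLeadingWord f w → ∀ a b : FreeMonoid X, u ≠ a * w * b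

/-- One elimination of the leading word of some `g ∈ S` in the word `u = a ḡ b`, with result the
word `v = u - a g b`. -/
def ELWStep [LinearOrder X] (S : Set (FreeAlg k X)) (u v : FreeMonoid X) : Prop :=
  ∃ g ∈ S, ∃ w a b : FreeMonoid X, IsLeadingWord g w ∧ u = a * w * b ∧
    word k v = word k u - word k a * g * word k b

end GSBasis

/-! ### The braid semigroup

The alphabet of `B⁺_{n+1}` is `Fin n`, where `x : Fin n` stands for the Artin generator
`a_{x+1}`, so that `a_1 < ⋯ < a_n`. -/

namespace BraidSemigroup

/-- The word in `a_1, …, a_n`, written as the list of its indices (between `1` and `n`). -/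
def indices {n : ℕ} (u : FreeMonoid (Fin n)) : List ℕ :=
  u.toList.map fun x => (x : ℕ) + 1

/-- The defining relations of the braid semigroup, on lists of indices. -/
inductive ArtinRel : List ℕ → List ℕ → Prop
  | braid (i : ℕ) : ArtinRel [i + 1, i, i + 1] [i, i + 1, i]
  | comm (i j : ℕ) (h : j + 2 ≤ i) : ArtinRel [i, j] [j, i]

/-- The defining relations of `B⁺_{n+1}`. -/
def artinRels (n : ℕ) (u v : FreeMonoid (Fin n)) : Prop :=
  ArtinRel (indices u) (indices v)

/-- The braid semigroup `B⁺_{n+1}` (with `1`). -/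
abbrev BraidMonoid (n : ℕ) : Type := PresentedMonoid (artinRels n)

/-- The indices of `a_{ij} = a_i a_{i-1} ⋯ a_j` for `i ≥ j`; the empty word for `j = i + 1`. -/
def desc (i j : ℕ) : List ℕ :=
  (List.range' j (i + 1 - j)).reverse

/-- The two families of relations, on lists of indices. -/
inductive BasisRel : List ℕ → List ℕ → Prop
  /-- `a_{i+1} a_i V(1,i-1) W(j,i) a_{i+1,j} = a_i a_{i+1} a_i V(1,i-1) a_{ij} W'(j+1,i+1)`,
  where `W` begins with `a_i` if it is not empty. -/
  | chain (i j : ℕ) (V W : List ℕ) (hi : 1 ≤ i) (hj : 1 ≤ j) (hji : j ≤ i + 1)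
      (hV : ∀ x ∈ V, 1 ≤ x ∧ x < i) (hW : ∀ x ∈ W, j ≤ x ∧ x ≤ i)
      (hW' : W ≠ [] → W.head? = some i) :
      BasisRel ([i + 1, i] ++ V ++ W ++ desc (i + 1) j)
        ([i, i + 1, i] ++ V ++ desc i j ++ W.map (· + 1))
  /-- `a_s a_k = a_k a_s` for `s - k ≥ 2`. -/
  | comm (s k : ℕ) (h : k + 2 ≤ s) : BasisRel [s, k] [k, s]

/-- The two families of relations, in the letters `a_1, …, a_n`. -/
def basisRels (n : ℕ) (u v : FreeMonoid (Fin n)) : Prop :=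
  BasisRel (indices u) (indices v)

/-- The polynomials `u - v` of the two families of relations. -/
def basis (k : Type*) [Field k] (n : ℕ) : Set (GSBasis.FreeAlg k (Fin n)) :=
  GSBasis.relPolys k (basisRels n)

end BraidSemigroup

/-! Compositions are not inspected one by one. Every element of the basis is a difference `u - v` of
words with `v < u`, so a composition relative to `w` is a difference of two words below `w` that
represent the same element of the semigroup. If each element has only one reduced word, eliminations
bring both words to that same reduced word, and the composition is trivial (`isGSBasis_relPolys`).
Everything thus rests on the uniqueness of reduced words (`Reduced.eq_of_el_eq`), which is proved
inside the semigroup.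

The tool is Garside's lemma (`compl_of_eq`): from `a_i x = a_j y` one gets `x = y` if `i = j`, and
otherwise both sides are multiples of the common multiple given by the commutation or braid
relation. So generators cancel on the left, and divisibility by a generator can be followed through
a word letter by letter.

With it, `Reduced.firstMin` shows that the first letter of a reduced word is the smallest generator
dividing its element on the left. If a smaller `a_y` divided the element of `x l`, induction on `l`
would leave only the case `x = y + 1`, with `l` equal to `y` followed by a tail divisible by `a_x`.
Reading that tail shows that it begins with some `V W a_{xj}`, so the whole word begins with a left
side of the chain relation. Two reduced words for one element therefore have the same first letter;
cancel it and induct.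

This is done over the letters `a_i`, `i : ℕ`; nothing is lost, since the Artin relations preserve
the set of letters (`mk_eq_mk_iff_el`). They also preserve length, so the class of a word is finite
and can be listed using the finitely many Artin relations. Its least member admits no elimination,
hence is the normal form, and this description makes it computable. -/

namespace BraidSemigroup

/-! ### The braid semigroup on infinitely many strands -/

/-- The Artin relations, on words in the letters `a_i`, `i : ℕ`. -/
def natRels (u v : FreeMonoid ℕ) : Prop := ArtinRel u.toList v.toList

/-- The braid semigroup on infinitely many strands. -/
abbrev NatBraid : Type := PresentedMonoid natRels

/-- The element of the braid semigroup represented by a list of indices. -/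
def el (l : List ℕ) : NatBraid := PresentedMonoid.mk natRels (FreeMonoid.ofList l)

/-- The generator `a_i`. -/
def gen (i : ℕ) : NatBraid := el [i]

theorem el_nil : el [] = 1 := rfl

theorem el_append (l r : List ℕ) : el (l ++ r) = el l * el r := rfl

theorem el_cons (x : ℕ) (l : List ℕ) : el (x :: l) = gen x * el l := rfl

theorem el_surjective (x : NatBraid) : ∃ l, el l = x :=
  PresentedMonoid.surjective_mk x

theorem el_eq_of_rel {l r : List ℕ} (h : ArtinRel l r) : el l = el r :=
  PresentedMonoid.mk_eq_mk_of_rel (rels := natRels) h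

/-- The indices `i`, `j` belong to commuting generators. -/
def Far (i j : ℕ) : Prop := i + 2 ≤ j ∨ j + 2 ≤ i

/-- The indices `i`, `j` belong to generators satisfying the braid relation. -/
def Adj (i j : ℕ) : Prop := i = j + 1 ∨ j = i + 1

theorem Far.symm {i j : ℕ} (h : Far i j) : Far j i := Or.symm h

theorem Adj.symm {i j : ℕ} (h : Adj i j) : Adj j i := Or.symm h

theorem eq_or_far_or_adj (i j : ℕ) : i = j ∨ Far i j ∨ Adj i j := by
  unfold Far Adj; omega

theorem gen_comm {i j : ℕ} (h : Far i j) : gen i * gen j = gen j * gen i := by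
  rcases h with h | h
  · exact (el_eq_of_rel (ArtinRel.comm j i h)).symm
  · exact el_eq_of_rel (ArtinRel.comm i j h)

theorem gen_comm_mul {i j : ℕ} (h : Far i j) (z : NatBraid) :
    gen i * (gen j * z) = gen j * (gen i * z) := by
  rw [← mul_assoc, gen_comm h, mul_assoc]

theorem gen_braid {i j : ℕ} (h : Adj i j) :
    gen i * (gen j * gen i) = gen j * (gen i * gen j) := by
  rcases h with rfl | rfl
  · exact el_eq_of_rel (ArtinRel.braid j)
  · exact (el_eq_of_rel (ArtinRel.braid i)).symm

theorem gen_braid_mul {i j : ℕ} (h : Adj i j) (z : NatBraid) :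
    gen i * (gen j * (gen i * z)) = gen j * (gen i * (gen j * z)) := by
  have := congrArg (· * z) (gen_braid h)
  simpa only [mul_assoc] using this

/-- The length homomorphism. -/
def lenHom : NatBraid →* Multiplicative ℕ :=
  PresentedMonoid.lift (fun _ => Multiplicative.ofAdd 1) (by
    intro a b h
    have key : ∀ c : FreeMonoid ℕ, FreeMonoid.lift (fun _ : ℕ => Multiplicative.ofAdd 1) c =
        Multiplicative.ofAdd c.toList.length := by
      intro c
      induction c using FreeMonoid.inductionOn' with
      | one => rfl
      | of_mul x c ih =>
        rw [map_mul, ih, FreeMonoid.toList_mul, List.length_append]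
        rfl
    rw [key, key]
    have : ∀ l r : List ℕ, ArtinRel l r → l.length = r.length := by
      intro l r h
      cases h <;> rfl
    rw [this _ _ h])

/-- The length of an element of the braid semigroup. -/
def len (x : NatBraid) : ℕ := Multiplicative.toAdd (lenHom x)

theorem len_mul (x y : NatBraid) : len (x * y) = len x + len y := by
  simp [len]

theorem len_gen (i : ℕ) : len (gen i) = 1 := rfl

theorem len_el (l : List ℕ) : len (el l) = l.length := by
  induction l with
  | nil => simp [el_nil, len]
  | cons x l ih => rw [el_cons, len_mul, ih, len_gen, List.length_cons, add_comm]

theorem length_eq_of_rel {u v : FreeMonoid ℕ} (h : ConGen.Rel natRels u v) :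
    u.toList.length = v.toList.length := by
  have e : el u.toList = el v.toList := PresentedMonoid.mk_eq_mk_iff.2 h
  rw [← len_el, e, len_el]

/-! ### Garside's lemma: cancellation and common multiples of two generators -/

/-- `x` and `y` are related as they have to be when `a_i x = a_j y`, if the least common multiple
of `a_i` and `a_j` is that of the braid or commutation relation. -/
def Compl (i j : ℕ) (x y : NatBraid) : Prop :=
  (i = j ∧ x = y) ∨ (Far i j ∧ ∃ z, x = gen j * z ∧ y = gen i * z) ∨
    (Adj i j ∧ ∃ z, x = gen j * (gen i * z) ∧ y = gen i * (gen j * z))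

namespace Compl

theorem symm {i j : ℕ} {x y : NatBraid} (h : Compl i j x y) : Compl j i y x := by
  rcases h with ⟨h, e⟩ | ⟨h, z, e, e'⟩ | ⟨h, z, e, e'⟩
  · exact .inl ⟨h.symm, e.symm⟩
  · exact .inr (.inl ⟨h.symm, z, e', e⟩)
  · exact .inr (.inr ⟨h.symm, z, e', e⟩)

theorem mul {i j : ℕ} {x y : NatBraid} (h : Compl i j x y) (t : NatBraid) :
    Compl i j (x * t) (y * t) := by
  rcases h with ⟨h, e⟩ | ⟨h, z, e, e'⟩ | ⟨h, z, e, e'⟩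
  · exact .inl ⟨h, by rw [e]⟩
  · exact .inr (.inl ⟨h, z * t, by rw [e, mul_assoc], by rw [e', mul_assoc]⟩)
  · exact .inr (.inr ⟨h, z * t, by simp only [e, mul_assoc], by simp only [e', mul_assoc]⟩)

theorem eq {i : ℕ} {x y : NatBraid} (h : Compl i i x y) : x = y := by
  rcases h with ⟨-, e⟩ | ⟨h, -⟩ | ⟨h, -⟩
  · exact e
  · unfold Far at h; omega
  · unfold Adj at h; omega

theorem far {i j : ℕ} {x y : NatBraid} (h : Compl i j x y) (hij : Far i j) :
    ∃ z, x = gen j * z ∧ y = gen i * z := by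
  rcases h with ⟨h, e⟩ | ⟨-, h⟩ | ⟨h, -⟩
  · unfold Far at hij; omega
  · exact h
  · unfold Adj at h; unfold Far at hij; omega

theorem adj {i j : ℕ} {x y : NatBraid} (h : Compl i j x y) (hij : Adj i j) :
    ∃ z, x = gen j * (gen i * z) ∧ y = gen i * (gen j * z) := by
  rcases h with ⟨h, e⟩ | ⟨h, -⟩ | ⟨-, h⟩
  · unfold Adj at hij; omega
  · unfold Adj at hij; unfold Far at h; omega
  · exact h

/-- Two commuting letters against a third one adjacent to one of them. -/
theorem trans_far_adj {L : ℕ}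
    (ih : ∀ i j x y, len x < L → gen i * x = gen j * y → Compl i j x y)
    {i k j : ℕ} {z r : NatBraid} (hz : len z < L) (hik : Far i k) (hkj : Adj k j)
    (e : gen i * z = gen j * (gen k * r)) : Compl i j (gen k * z) (gen k * (gen j * r)) := by
  have hL := congrArg len e
  simp only [len_mul, len_gen] at hL
  rcases eq_or_far_or_adj i j with rfl | hij | hij
  · unfold Far at hik; unfold Adj at hkj; omega
  · obtain ⟨q, rfl, e1⟩ := (ih _ _ _ _ hz e).far hij
    obtain ⟨t, rfl, rfl⟩ := (ih _ _ _ _ (by omega) e1).far hik.symm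
    refine .inr (.inl ⟨hij, gen k * (gen j * t), ?_, ?_⟩)
    · rw [gen_braid_mul hkj]
    · rw [gen_comm_mul hij.symm, gen_comm_mul hik.symm]
  · obtain ⟨q, rfl, e1⟩ := (ih _ _ _ _ hz e).adj hij
    obtain ⟨t, rfl, e2⟩ := (ih _ _ _ _ (by omega) e1).far hik.symm
    simp only [len_mul, len_gen] at hz hL
    have hL1 := congrArg len e2
    simp only [len_mul, len_gen] at hL1
    obtain ⟨s, rfl, rfl⟩ := (ih _ _ _ _ (by omega) e2).adj hkj.symm
    -- Here `j` is adjacent to both `i` and `k`, and `gen i * (gen k * z)` has become the half twist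
    -- on four strands times `s`.
    refine .inr (.inr ⟨hij, gen k * (gen j * (gen i * s)), ?_, ?_⟩)
    · rw [gen_comm_mul hik, gen_braid_mul hkj, gen_braid_mul hij.symm, gen_comm_mul hik.symm]
    · rw [gen_braid_mul hij.symm, gen_comm_mul hik.symm, gen_comm_mul hik s, gen_braid_mul hkj]

/-- One letter against two letters adjacent to it. -/
theorem trans_adj_adj {L : ℕ}
    (ih : ∀ i j x y, len x < L → gen i * x = gen j * y → Compl i j x y)
    {i k j : ℕ} {z r : NatBraid} (hz : len z + 1 < L) (hik : Adj i k) (hkj : Adj k j)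
    (e : gen i * (gen k * z) = gen j * (gen k * r)) :
    Compl i j (gen k * (gen i * z)) (gen k * (gen j * r)) := by
  have hlen : len (gen k * z) < L := by rw [len_mul, len_gen]; omega
  rcases eq_or_far_or_adj i j with rfl | hij | hij
  · exact .inl ⟨rfl, by rw [(ih _ _ _ _ (by omega) (ih _ _ _ _ hlen e).eq).eq]⟩
  · obtain ⟨q, e1, e2⟩ := (ih _ _ _ _ hlen e).far hij
    have hL1 := congrArg len e1
    have hL2 := congrArg len e2
    simp only [len_mul, len_gen] at hL1 hL2
    obtain ⟨t, rfl, rfl⟩ := (ih _ _ _ _ (by omega) e1).adj hkj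
    obtain ⟨t', rfl, e3⟩ := (ih _ _ _ _ (by omega) e2).adj hik.symm
    simp only [len_mul, len_gen] at hz
    have e4 := (ih _ _ _ _ (by simp only [len_mul, len_gen]; omega) e3).eq
    obtain ⟨s, rfl, rfl⟩ := (ih _ _ _ _ (by omega) e4).far hij.symm
    -- Again the common multiple is the half twist on four strands times `s`, now with `k` as the
    -- middle generator.
    refine .inr (.inl ⟨hij, gen k * (gen j * (gen i * (gen k * s))), ?_, ?_⟩)
    · rw [gen_comm_mul hij, gen_braid_mul hik, gen_braid_mul hkj]
    · rw [gen_comm_mul hij.symm, gen_braid_mul hkj.symm, gen_braid_mul hik.symm,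
        gen_comm_mul hij]
  · unfold Adj at *; omega

/-- This is the heart of Garside's induction: in a chain `a_i x = a_k u = a_j y`, two descriptions
of `u` are compared. They give an equation between elements shorter than `u`, to which `ih` applies.
-/
theorem trans {L : ℕ}
    (ih : ∀ i j x y, len x < L → gen i * x = gen j * y → Compl i j x y)
    {i k j : ℕ} {x u y : NatBraid} (hx : len u = L)
    (h : Compl i k x u) (h' : Compl k j u y) : Compl i j x y := by
  rcases h with ⟨rfl, rfl⟩ | ⟨hik, z, rfl, rfl⟩ | ⟨hik, z, rfl, rfl⟩
  · exact h'
  · rw [len_mul, len_gen] at hx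
    rcases h' with ⟨rfl, rfl⟩ | ⟨hkj, r, e, rfl⟩ | ⟨hkj, r, e, rfl⟩
    · exact .inr (.inl ⟨hik, z, rfl, rfl⟩)
    · rcases ih _ _ _ _ (by omega) e with ⟨rfl, rfl⟩ | ⟨hij, q, rfl, rfl⟩ | ⟨hij, q, rfl, rfl⟩
      · exact .inl ⟨rfl, rfl⟩
      · exact .inr (.inl ⟨hij, gen k * q, gen_comm_mul hkj q, gen_comm_mul hik.symm q⟩)
      · refine .inr (.inr ⟨hij, gen k * q, ?_, ?_⟩)
        · rw [gen_comm_mul hkj, gen_comm_mul hik.symm]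
        · rw [gen_comm_mul hik.symm, gen_comm_mul hkj]
    · exact trans_far_adj ih (by omega) hik hkj e
  · simp only [len_mul, len_gen] at hx
    rcases h' with ⟨rfl, rfl⟩ | ⟨hkj, r, e, rfl⟩ | ⟨hkj, r, e, rfl⟩
    · exact .inr (.inr ⟨hik, z, rfl, rfl⟩)
    · have hL := congrArg len e
      simp only [len_mul, len_gen] at hL
      exact (trans_far_adj ih (by omega) hkj.symm hik.symm e.symm).symm
    · exact trans_adj_adj ih (by omega) hik hkj e

end Compl

/-- Garside's lemma on left divisibility by two generators, for equivalent words. -/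
theorem compl_of_rel {L : ℕ}
    (ih : ∀ i j x y, len x < L → gen i * x = gen j * y → Compl i j x y)
    {u v : FreeMonoid ℕ} (h : ConGen.Rel natRels u v) :
    ∀ i j (l r : List ℕ), u.toList = i :: l → v.toList = j :: r → l.length ≤ L →
      Compl i j (el l) (el r) := by
  induction h with
  | of u v h =>
    intro i j l r hl hr _
    unfold natRels at h
    rw [hl, hr] at h
    cases h with
    | braid i => exact .inr (.inr ⟨.inl rfl, 1, rfl, rfl⟩)
    | comm i j h => exact .inr (.inl ⟨.inr h, 1, rfl, rfl⟩)
  | refl u =>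
    intro i j l r hl hr _
    obtain ⟨rfl, rfl⟩ := List.cons.inj (hl.symm.trans hr)
    exact .inl ⟨rfl, rfl⟩
  | symm h IH =>
    intro i j l r hl hr hL
    have hlen := length_eq_of_rel h
    rw [hl, hr] at hlen
    simp only [List.length_cons] at hlen
    exact (IH j i r l hr hl (by omega)).symm
  | @trans u v w h h' IH IH' =>
    intro i j l r hl hr hL
    have hlen := length_eq_of_rel h
    rw [hl] at hlen
    -- The middle word has the same length, so it too has a first letter, and its tail is no longer
    -- than `L`.
    obtain ⟨k, m, hm⟩ := List.exists_cons_of_length_pos (l := v.toList) (by simp [← hlen])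
    rw [hm] at hlen
    simp only [List.length_cons] at hlen
    refine Compl.trans (L := len (el m)) (fun i j x y hx => ih i j x y ?_) rfl
      (IH i k l m hl hm hL) (IH' k j m r hm hr (by omega))
    rw [len_el] at hx
    omega
  | @mul u u' v v' h h' IH IH' =>
    intro i j l r hl hr hL
    have hlen := length_eq_of_rel h
    rw [FreeMonoid.toList_mul] at hl hr
    -- The first letter of a product lies in the first factor unless that is empty; `u` and `u'` are
    -- empty together, having equal lengths.
    rcases hu : u.toList with _ | ⟨a, s⟩
    · rcases hu' : u'.toList with _ | ⟨a', s'⟩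
      · rw [hu] at hl
        rw [hu'] at hr
        exact IH' i j l r hl hr hL
      · rw [hu, hu'] at hlen
        simp at hlen
    · rcases hu' : u'.toList with _ | ⟨a', s'⟩
      · rw [hu, hu'] at hlen
        simp at hlen
      · rw [hu] at hl
        rw [hu'] at hr
        obtain ⟨rfl, rfl⟩ := List.cons.inj hl
        obtain ⟨rfl, rfl⟩ := List.cons.inj hr
        have hL : (s ++ v.toList).length ≤ L := hL
        rw [List.length_append] at hL
        have := (IH _ _ _ _ hu hu' (by omega)).mul (el v.toList)
        change Compl _ _ (el s * el v.toList) (el s' * el v'.toList)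
        convert this using 2
        exact (PresentedMonoid.mk_eq_mk_iff.2 h' : el _ = el _).symm

/-- Garside's lemma: the generators cancel on the left, and have least common right multiples. -/
theorem compl_of_eq {i j : ℕ} {x y : NatBraid} (e : gen i * x = gen j * y) : Compl i j x y := by
  obtain ⟨L, hL⟩ : ∃ L, len x = L := ⟨_, rfl⟩
  induction L using Nat.strong_induction_on generalizing i j x y with
  | _ L ih =>
    obtain ⟨l, rfl⟩ := el_surjective x
    obtain ⟨r, rfl⟩ := el_surjective y
    rw [len_el] at hL
    exact compl_of_rel (L := L) (fun i j x y hx e => ih _ hx e rfl)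
      (PresentedMonoid.mk_eq_mk_iff.1 (show el (i :: l) = el (j :: r) from e)) i j l r rfl rfl hL.le

theorem gen_mul_cancel {i : ℕ} {x y : NatBraid} (e : gen i * x = gen i * y) : x = y :=
  (compl_of_eq e).eq

end BraidSemigroup

namespace BraidSemigroup

/-! ### Reduced words over the natural numbers -/

theorem desc_succ {i j : ℕ} (h : j ≤ i + 1) : desc (i + 1) j = (i + 1) :: desc i j := by
  unfold desc
  rw [show i + 1 + 1 - j = (i + 1 - j) + 1 by omega, List.range'_concat, List.reverse_append]
  simp only [List.reverse_cons, List.reverse_nil, List.nil_append, List.singleton_append]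
  congr 1
  omega

theorem desc_eq_nil {i j : ℕ} (h : i < j) : desc i j = [] := by
  unfold desc
  rw [show i + 1 - j = 0 by omega]
  rfl

theorem mem_desc {i j x : ℕ} : x ∈ desc i j ↔ j ≤ x ∧ x ≤ i := by
  unfold desc
  rw [List.mem_reverse, List.mem_range'_1]
  omega

/-! ### Commutation with the descending words and divisibility by them -/

/-- `a_m` commutes with the words in letters far from it. -/
theorem gen_mul_el_comm {m : ℕ} {l : List ℕ} (h : ∀ x ∈ l, Far m x) :
    gen m * el l = el l * gen m := by
  induction l with
  | nil => rw [el_nil, one_mul, mul_one]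
  | cons x l ih =>
    rw [List.forall_mem_cons] at h
    rw [el_cons, mul_assoc, ← ih h.2, gen_comm_mul h.1]

/-- If `a_m` divides `t z` on the left, for a word `t` in letters far from `m`, then it
divides `z`. -/
theorem eq_mul_of_far {m : ℕ} {l : List ℕ} (h : ∀ x ∈ l, Far m x) {z y : NatBraid}
    (e : el l * z = gen m * y) : ∃ w, z = gen m * w ∧ y = el l * w := by
  induction l generalizing y with
  | nil => exact ⟨y, by rwa [el_nil, one_mul] at e, by rw [el_nil, one_mul]⟩
  | cons x l ih =>
    rw [List.forall_mem_cons] at h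
    rw [el_cons, mul_assoc] at e
    obtain ⟨w, e1, rfl⟩ := (compl_of_eq e).far h.1.symm
    obtain ⟨w', e2, rfl⟩ := ih h.2 e1
    exact ⟨w', e2, by rw [el_cons, mul_assoc]⟩

/-- The word `a_{mj}` moves past a letter of `a_j, …, a_{m-1}`, lowering the index by one. -/
theorem gen_mul_el_desc {m j b : ℕ} (hj1 : 1 ≤ j) (hj : j ≤ b) (hb : b < m) :
    gen b * el (desc m j) = el (desc m j) * gen (b + 1) := by
  induction m with
  | zero => omega
  | succ m ih =>
    rw [desc_succ (by omega), el_cons]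
    rcases Nat.lt_succ_iff_lt_or_eq.1 hb with hb | rfl
    · rw [gen_comm_mul (.inl (by omega)), ih hb, mul_assoc]
    -- The letter meets its own index: one braid move creates the raised letter, which commutes with
    -- the rest of the descending word. The bound `1 ≤ j` makes the letter a successor, so that
    -- `desc_succ` applies.
    · obtain ⟨b, rfl⟩ := Nat.exists_eq_add_of_le' (hj1.trans hj)
      rw [desc_succ hj, el_cons, mul_assoc, mul_assoc,
        ← gen_mul_el_comm (m := b + 1 + 1) (l := desc b j), gen_braid_mul (.inr rfl)]
      intro x hx
      rw [mem_desc] at hx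
      exact .inr (by omega)

/-- A word in `a_j, …, a_{m-1}` moves past `a_{mj}`, with all indices raised by one. -/
theorem el_mul_el_desc {m j : ℕ} (hj1 : 1 ≤ j) {W : List ℕ} (hW : ∀ x ∈ W, j ≤ x ∧ x < m) :
    el W * el (desc m j) = el (desc m j) * el (W.map (· + 1)) := by
  induction W with
  | nil => simp [el_nil]
  | cons x W ih =>
    rw [List.forall_mem_cons] at hW
    rw [el_cons, mul_assoc, ih hW.2, ← mul_assoc, gen_mul_el_desc hj1 hW.1.1 hW.1.2, mul_assoc,
      List.map_cons, el_cons]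

/-- The relations of the basis hold in the braid semigroup. -/
theorem el_eq_of_basisRel {p q : List ℕ} (h : BasisRel p q) : el p = el q := by
  cases h with
  | comm s k h => exact el_eq_of_rel (.comm s k h)
  | chain i j V W hi hj hji hV hW hW' =>
    have hc : gen (i + 1) * el V = el V * gen (i + 1) :=
      gen_mul_el_comm fun x hx => .inr (by have := hV x hx; omega)
    have hm := el_mul_el_desc (m := i + 1) hj fun x hx => ⟨(hW x hx).1, by have := hW x hx; omega⟩
    calc el ([i + 1, i] ++ V ++ W ++ desc (i + 1) j)
        = gen (i + 1) * (gen i * (el V * (el W * el (desc (i + 1) j)))) := by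
          simp only [el_append, el_cons, el_nil, mul_assoc, one_mul]
      _ = gen (i + 1) * (gen i * (gen (i + 1) * (el V * (el (desc i j) *
            el (W.map (· + 1)))))) := by
          rw [hm, desc_succ hji, el_cons, ← mul_assoc (gen (i + 1)) (el V), hc]
          simp only [mul_assoc]
      _ = el ([i, i + 1, i] ++ V ++ desc i j ++ W.map (· + 1)) := by
          rw [gen_braid_mul (.inl rfl)]
          simp only [el_append, el_cons, el_nil, mul_assoc, one_mul]

/-- If `a_{mj}` divides `a_b y`, `j ≤ b < m`, then it divides `y`. -/
theorem exists_eq_el_desc_mul {m j b : ℕ} (hj1 : 1 ≤ j) (hj : j ≤ b) (hb : b < m)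
    {y z : NatBraid} (e : gen b * y = el (desc m j) * z) : ∃ w, y = el (desc m j) * w := by
  induction m generalizing y z with
  | zero => omega
  | succ m ih =>
    rw [desc_succ (by omega), el_cons, mul_assoc] at e
    rcases Nat.lt_succ_iff_lt_or_eq.1 hb with hb | rfl
    · obtain ⟨u, rfl, e1⟩ := (compl_of_eq e).far (.inl (by omega))
      obtain ⟨w, rfl⟩ := ih hb e1.symm
      exact ⟨w, by rw [desc_succ (by omega), el_cons, mul_assoc]⟩
    · obtain ⟨u, rfl, e1⟩ := (compl_of_eq e).adj (.inr rfl)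
      obtain ⟨b, rfl⟩ := Nat.exists_eq_add_of_le' (hj1.trans hj)
      rw [desc_succ hj, el_cons, mul_assoc] at e1
      obtain ⟨w, rfl, rfl⟩ := eq_mul_of_far (fun x hx => .inr (by rw [mem_desc] at hx; omega))
        (gen_mul_cancel e1)
      exact ⟨w, by rw [desc_succ (by omega), desc_succ hj, el_cons, el_cons, mul_assoc, mul_assoc]⟩

/-- If `a_{m,b+1}` divides `a_b y`, `b < m`, then `a_{mb}` divides `y`. -/
theorem exists_eq_el_desc_mul_pred {m b : ℕ} (hb1 : 1 ≤ b) (hb : b < m)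
    {y z : NatBraid} (e : gen b * y = el (desc m (b + 1)) * z) :
    ∃ w, y = el (desc m b) * w := by
  induction m generalizing y z with
  | zero => omega
  | succ m ih =>
    rw [desc_succ (by omega), el_cons, mul_assoc] at e
    rcases Nat.lt_succ_iff_lt_or_eq.1 hb with hb | rfl
    · obtain ⟨u, rfl, e1⟩ := (compl_of_eq e).far (.inl (by omega))
      obtain ⟨w, rfl⟩ := ih hb e1.symm
      exact ⟨w, by rw [desc_succ (by omega), el_cons, mul_assoc]⟩
    · obtain ⟨u, rfl, -⟩ := (compl_of_eq e).adj (.inr rfl)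
      obtain ⟨b, rfl⟩ := Nat.exists_eq_add_of_le' hb1
      refine ⟨u, ?_⟩
      rw [desc_succ (by omega), desc_succ (by omega), desc_eq_nil (by omega)]
      simp only [el_cons, el_nil, mul_one, mul_assoc]

/-! ### Reduced words are determined by their elements -/

/-- A word is reduced if it has no subword which is the left hand side of a basis relation. -/
def Reduced (l : List ℕ) : Prop := ∀ a b p q, BasisRel p q → l ≠ a ++ p ++ b

theorem Reduced.of_cons {x : ℕ} {l : List ℕ} (h : Reduced (x :: l)) : Reduced l := by
  rintro a b p q hpq rfl
  exact h (x :: a) b p q hpq rfl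

theorem Reduced.lt_add_two {x y : ℕ} {l : List ℕ} (h : Reduced (x :: y :: l)) : x < y + 2 := by
  by_contra! hc
  exact h [] l _ _ (.comm x y hc) rfl

/-- The first letter of the word is minimal among the letters dividing its element. -/
def FirstMin (l : List ℕ) : Prop := ∀ x z, el l = gen x * z → ∃ y t, l = y :: t ∧ y ≤ x

/-- In a reduced word a letter exceeds its successor by at most one, while `FirstMin` bounds the
successor from above by a dividing letter. Together these force the descending word letter by
letter. -/
theorem exists_eq_desc_append {m j : ℕ} {t : List ℕ} (hr : Reduced ((m + 1) :: t))
    (hf : ∀ s, s <:+ t → FirstMin s) {z : NatBraid} (e : el t = el (desc m j) * z) (hj : 1 ≤ j) :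
    ∃ r, t = desc m j ++ r := by
  induction m generalizing t with
  | zero => exact ⟨t, by rw [desc_eq_nil (by omega)]; rfl⟩
  | succ m ih =>
    rcases lt_or_ge (m + 1) j with h | h
    · exact ⟨t, by rw [desc_eq_nil h]; rfl⟩
    · rw [desc_succ h, el_cons, mul_assoc] at e
      obtain ⟨y, t, rfl, hy⟩ := hf t List.suffix_rfl _ _ e
      have := hr.lt_add_two
      obtain rfl : y = m + 1 := by omega
      obtain ⟨r, rfl⟩ := ih hr.of_cons (fun s hs => hf s (hs.trans (List.suffix_cons _ _)))
        (gen_mul_cancel e)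
      exact ⟨r, by rw [desc_succ h]; rfl⟩

/-- This locates the rest of `W` and the descending word after it. The next letter `b` satisfies `c
- 1 ≤ b ≤ m + 1`. If `b = m + 1`, the descending word starts here. If `j ≤ b ≤ m`, then `b` joins
`W` and the divisor persists. If `b = j - 1`, the divisor grows to `a_{m+1,j-1}`; hence `j'` may be
smaller than `j`. -/
theorem exists_eq_append_desc {m j c : ℕ} {t : List ℕ} (hr : Reduced (c :: t))
    (hf : ∀ s, s <:+ t → FirstMin s) (h1 : ∀ x ∈ t, 1 ≤ x) (hj : 1 ≤ j) (hjc : j ≤ c)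
    (hcm : c ≤ m) {z : NatBraid} (e : el t = el (desc (m + 1) j) * z) :
    ∃ j' W r, 1 ≤ j' ∧ j' ≤ j ∧ (∀ x ∈ W, j' ≤ x ∧ x ≤ m) ∧
      t = W ++ desc (m + 1) j' ++ r := by
  induction t generalizing j c z with
  | nil =>
    rw [desc_succ (by omega), el_cons, mul_assoc] at e
    obtain ⟨y, t, h, -⟩ := hf [] List.suffix_rfl _ _ e
    cases h
  | cons b t ih =>
    have hf' : ∀ s, s <:+ t → FirstMin s := fun s hs => hf s (hs.trans (List.suffix_cons _ _))
    have hb1 := h1 b (by simp)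
    have h1' : ∀ x ∈ t, 1 ≤ x := fun x hx => h1 x (by simp [hx])
    have e' := e
    rw [desc_succ (by omega), el_cons (m + 1), mul_assoc] at e'
    obtain ⟨y, t', h, hbm⟩ := hf _ List.suffix_rfl _ _ e'
    obtain ⟨rfl, rfl⟩ := List.cons.inj h
    have hcb := hr.lt_add_two
    rw [el_cons] at e e'
    rcases Nat.le_succ_iff_eq_or_le.1 hbm with rfl | hbm
    · obtain ⟨r, rfl⟩ := exists_eq_desc_append hr.of_cons hf' (gen_mul_cancel e') hj
      exact ⟨j, [], r, hj, le_rfl, by simp, by rw [desc_succ (by omega)]; rfl⟩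
    · rcases le_or_gt j b with hjb | hjb
      · obtain ⟨w, e1⟩ := exists_eq_el_desc_mul hj hjb (by omega) e
        obtain ⟨j', W, r, g1, g2, g3, rfl⟩ := ih hr.of_cons hf' h1' hj hjb hbm e1
        refine ⟨j', b :: W, r, g1, g2, ?_, rfl⟩
        rw [List.forall_mem_cons]
        exact ⟨by omega, g3⟩
      · obtain rfl : j = b + 1 := by omega
        obtain ⟨w, e1⟩ := exists_eq_el_desc_mul_pred hb1 (by omega) e
        obtain ⟨j', W, r, g1, g2, g3, rfl⟩ := ih hr.of_cons hf' h1' hb1 le_rfl hbm e1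
        refine ⟨j', b :: W, r, g1, by omega, ?_, rfl⟩
        rw [List.forall_mem_cons]
        exact ⟨by omega, g3⟩

/-- The first letter `b` is at most `i + 1`. Letters below `i` commute with `a_{i+1}` and are
collected in `V`. A letter `i` opens `W`, and by the braid case of Garside's lemma the rest is
divisible by `a_{i+1} a_i`. A letter `i + 1` ends the search with `W` empty. -/
theorem exists_eq_append_append_desc {i : ℕ} {t : List ℕ} (hi : 1 ≤ i) (hr : Reduced t)
    (hf : ∀ s, s <:+ t → FirstMin s) (h1 : ∀ x ∈ t, 1 ≤ x) {z : NatBraid}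
    (e : el t = gen (i + 1) * z) :
    ∃ j V W r, 1 ≤ j ∧ j ≤ i + 1 ∧ (∀ x ∈ V, 1 ≤ x ∧ x < i) ∧ (∀ x ∈ W, j ≤ x ∧ x ≤ i) ∧
      (W ≠ [] → W.head? = some i) ∧ t = V ++ W ++ desc (i + 1) j ++ r := by
  induction t generalizing z with
  | nil =>
    obtain ⟨y, t, h, -⟩ := hf [] List.suffix_rfl _ _ e
    cases h
  | cons b t ih =>
    have hf' : ∀ s, s <:+ t → FirstMin s := fun s hs => hf s (hs.trans (List.suffix_cons _ _))
    have hb1 := h1 b (by simp)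
    have h1' : ∀ x ∈ t, 1 ≤ x := fun x hx => h1 x (by simp [hx])
    obtain ⟨y, t', h, hbm⟩ := hf _ List.suffix_rfl _ _ e
    obtain ⟨rfl, rfl⟩ := List.cons.inj h
    rw [el_cons] at e
    rcases lt_trichotomy b i with hb | rfl | hb
    · obtain ⟨w, e1, -⟩ := (compl_of_eq e).far (.inl (by omega))
      obtain ⟨j, V, W, r, g1, g2, g3, g4, g5, rfl⟩ := ih hr.of_cons hf' h1' e1
      refine ⟨j, b :: V, W, r, g1, g2, ?_, g4, g5, rfl⟩
      rw [List.forall_mem_cons]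
      exact ⟨by omega, g3⟩
    · obtain ⟨w, e1, -⟩ := (compl_of_eq e).adj (.inr rfl)
      have e2 : el t = el (desc (b + 1) b) * w := by
        obtain ⟨b, rfl⟩ := Nat.exists_eq_add_of_le' hb1
        rw [desc_succ (by omega), desc_succ (by omega), desc_eq_nil (by omega), e1]
        simp only [el_cons, el_nil, mul_one, mul_assoc]
      obtain ⟨j, W, r, g1, g2, g3, rfl⟩ := exists_eq_append_desc hr hf' h1' hb1 le_rfl le_rfl e2
      refine ⟨j, [], b :: W, r, g1, by omega, by simp, ?_, fun _ => rfl, rfl⟩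
      rw [List.forall_mem_cons]
      exact ⟨by omega, g3⟩
    · obtain rfl : b = i + 1 := by omega
      refine ⟨i + 1, [], [], t, by omega, le_rfl, by simp, by simp, by simp, ?_⟩
      rw [desc_succ le_rfl, desc_eq_nil (by omega)]
      rfl

/-- All suffixes are treated at once because the search for a forbidden subword uses minimality for
every shorter suffix. -/
theorem Reduced.firstMin {l : List ℕ} (hr : Reduced l) (h1 : ∀ x ∈ l, 1 ≤ x) :
    ∀ s, s <:+ l → FirstMin s := by
  induction l with
  | nil =>
    intro s hs x z e
    obtain rfl := List.suffix_nil.1 hs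
    have := congrArg len e
    rw [len_mul, len_el, len_gen, List.length_nil] at this
    omega
  | cons x l ih =>
    have h1' : ∀ y ∈ l, 1 ≤ y := fun y hy => h1 y (by simp [hy])
    have hf := ih hr.of_cons h1'
    intro s hs
    rcases List.suffix_cons_iff.1 hs with rfl | hs
    · intro y z e
      refine ⟨x, l, rfl, ?_⟩
      by_contra! hyx
      rw [el_cons] at e
      rcases compl_of_eq e with ⟨h, -⟩ | ⟨h, w, e1, -⟩ | ⟨h, w, e1, -⟩
      · omega
      · obtain ⟨b, t, rfl, hb⟩ := hf l List.suffix_rfl _ _ e1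
        have := hr.lt_add_two
        unfold Far at h
        omega
      · obtain ⟨b, t, rfl, hb⟩ := hf l List.suffix_rfl _ _ e1
        have := hr.lt_add_two
        unfold Adj at h
        obtain rfl : b = y := by omega
        obtain rfl : x = b + 1 := by omega
        have hb1 := h1' b (by simp)
        -- The word starts with `b + 1, b`, and the part after these letters is divisible by
        -- `a_{b+1}`; this exhibits a left side of the chain relation at its very beginning.
        obtain ⟨j, V, W, r, g1, g2, g3, g4, g5, rfl⟩ := exists_eq_append_append_desc hb1
          hr.of_cons.of_cons (fun s hs => hf s (hs.trans (List.suffix_cons _ _)))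
          (fun y hy => h1' y (by simp [hy])) (gen_mul_cancel e1)
        exact hr [] r _ _ (.chain b j V W hb1 g1 g2 g3 g4 g5) (by simp)
    · exact hf s hs

/-- Reduced words representing the same element are equal. -/
theorem Reduced.eq_of_el_eq {l r : List ℕ} (hl : Reduced l) (hr : Reduced r)
    (hl1 : ∀ x ∈ l, 1 ≤ x) (hr1 : ∀ x ∈ r, 1 ≤ x) (e : el l = el r) : l = r := by
  induction l generalizing r with
  | nil =>
    have := congrArg len e
    rw [len_el, len_el] at this
    exact (List.length_eq_zero_iff.1 this.symm).symm
  | cons x l ih =>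
    obtain ⟨y, r, rfl, hyx⟩ := hr.firstMin hr1 r List.suffix_rfl x (el l) e.symm
    obtain ⟨_, _, h, hxy⟩ := hl.firstMin hl1 _ List.suffix_rfl y (el r) e
    obtain ⟨rfl, rfl⟩ := List.cons.inj h
    obtain rfl : x = y := le_antisymm hxy hyx
    rw [ih hl.of_cons hr.of_cons (fun z hz => hl1 z (by simp [hz]))
      (fun z hz => hr1 z (by simp [hz])) (gen_mul_cancel e)]

end BraidSemigroup

namespace GSBasis

variable {X : Type*} {k : Type*} [Field k]

/-! ### Polynomials `u - v` with `v < u` -/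

theorem word_mul (u v : FreeMonoid X) : word k (u * v) = word k u * word k v :=
  map_mul _ _ _

theorem word_injective : Function.Injective (word k : FreeMonoid X → FreeAlg k X) :=
  MonoidAlgebra.of_injective

theorem mul_sub_mul_word (a u v b : FreeMonoid X) :
    word k a * (word k u - word k v) * word k b = word k (a * u * b) - word k (a * v * b) := by
  simp only [word_mul, mul_sub, sub_mul]

/-- Equal lengths matter: a proper prefix precedes its extension, and appending `c` could reverse
that. -/
theorem lex_append_of_length_eq {r : X → X → Prop} {s t : List X} (h : List.Lex r s t)
    (hlen : s.length = t.length) (c : List X) : List.Lex r (s ++ c) (t ++ c) := by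
  induction h with
  | nil => simp at hlen
  | rel h => exact .rel h
  | cons _ ih => exact .cons (ih (by simpa using hlen))

open Classical in
theorem coeff_word_sub_word (u v w : FreeMonoid X) : (word k u - word k v).coeff w =
    (if u = w then 1 else 0) - (if v = w then 1 else 0) := by
  simp only [word, MonoidAlgebra.of_apply, MonoidAlgebra.coeff_sub, Finsupp.sub_apply,
    MonoidAlgebra.coeff_single, Finsupp.single_apply]

section DegLex

variable [LinearOrder X]

theorem DegLex.ne {u v : FreeMonoid X} (h : DegLex u v) : u ≠ v := by
  rintro rfl
  exact Std.Asymm.asymm (r := List.Shortlex (· < · : X → X → Prop)) _ _ h h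

theorem DegLex.asymm {u v : FreeMonoid X} (h : DegLex u v) : ¬ DegLex v u :=
  Std.Asymm.asymm (r := List.Shortlex (· < · : X → X → Prop)) _ _ h

theorem DegLex.trans {u v w : FreeMonoid X} (h : DegLex u v) (h' : DegLex v w) : DegLex u w := by
  unfold DegLex at *
  rw [List.shortlex_def] at *
  rcases h with h | ⟨h, hl⟩ <;> rcases h' with h' | ⟨h', hl'⟩
  · exact .inl (h.trans h')
  · exact .inl (h' ▸ h)
  · exact .inl (h ▸ h')
  · exact .inr ⟨h.trans h', List.lt_trans hl hl'⟩

theorem DegLex.mul {u v : FreeMonoid X} (h : DegLex u v) (a b : FreeMonoid X) :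
    DegLex (a * u * b) (a * v * b) := by
  unfold DegLex at *
  rw [mul_assoc, mul_assoc]
  simp only [FreeMonoid.toList_mul]
  apply List.Shortlex.append_left
  rw [List.shortlex_def] at *
  simp only [List.length_append]
  rcases h with h | ⟨h, hl⟩
  · exact .inl (by omega)
  · exact .inr ⟨by omega, lex_append_of_length_eq hl h _⟩

theorem coeff_word_sub_word_self {u v : FreeMonoid X} (h : DegLex v u) :
    (word k u - word k v).coeff u = 1 := by
  rw [coeff_word_sub_word, if_pos rfl, if_neg h.ne, sub_zero]

theorem isLeadingWord_sub {u v : FreeMonoid X} (h : DegLex v u) :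
    IsLeadingWord (word k u - word k v) u := by
  refine ⟨?_, fun w hw hwu => ?_⟩
  · rw [Finsupp.mem_support_iff, coeff_word_sub_word_self h]
    exact one_ne_zero
  · rw [Finsupp.mem_support_iff, coeff_word_sub_word, if_neg (Ne.symm hwu)] at hw
    by_cases e : v = w
    · exact e ▸ h
    · simp [e] at hw

theorem IsLeadingWord.unique {f : FreeAlg k X} {u v : FreeMonoid X} (h : IsLeadingWord f u)
    (h' : IsLeadingWord f v) : u = v := by
  by_contra hne
  exact (h.2 v h'.1 (Ne.symm hne)).asymm (h'.2 u h.1 hne)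

/-! ### Eliminations for relations whose right side is smaller -/

section Rels

variable {rels : FreeMonoid X → FreeMonoid X → Prop}

theorem isReduced_relPolys_iff
    (hlt : ∀ u v, rels u v → DegLex v u) {u : FreeMonoid X} : IsReduced (relPolys k rels) u ↔
    ∀ p q a b, rels p q → u ≠ a * p * b := by
  constructor
  · intro h p q a b hpq
    exact h _ ⟨p, q, hpq, rfl⟩ p (isLeadingWord_sub (hlt _ _ hpq)) a b
  · rintro h _ ⟨p, q, hpq, rfl⟩ w hw a b
    obtain rfl := hw.unique (isLeadingWord_sub (hlt _ _ hpq))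
    exact h w q a b hpq

theorem elwStep_relPolys_iff
    (hlt : ∀ u v, rels u v → DegLex v u) {u v : FreeMonoid X} : ELWStep (relPolys k rels) u v ↔
    ∃ p q a b, rels p q ∧ u = a * p * b ∧ v = a * q * b := by
  constructor
  · rintro ⟨_, ⟨p, q, hpq, rfl⟩, w, a, b, hw, rfl, h⟩
    obtain rfl := hw.unique (isLeadingWord_sub (hlt _ _ hpq))
    refine ⟨w, q, a, b, hpq, rfl, word_injective (k := k) ?_⟩
    rw [h, mul_sub_mul_word, sub_sub_cancel]
  · rintro ⟨p, q, a, b, hpq, rfl, rfl⟩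
    exact ⟨_, ⟨p, q, hpq, rfl⟩, p, a, b, isLeadingWord_sub (hlt _ _ hpq), rfl, by
      rw [mul_sub_mul_word, sub_sub_cancel]⟩

theorem degLex_of_elwStep
    (hlt : ∀ u v, rels u v → DegLex v u) {u v : FreeMonoid X} (h : ELWStep (relPolys k rels) u v) :
    DegLex v u := by
  obtain ⟨p, q, a, b, hpq, rfl, rfl⟩ := (elwStep_relPolys_iff hlt).1 h
  exact (hlt _ _ hpq).mul a b

theorem wellFounded_elwStep [WellFoundedLT X]
    (hlt : ∀ u v, rels u v → DegLex v u) :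
    WellFounded (fun v u : FreeMonoid X => ELWStep (relPolys k rels) u v) :=
  Subrelation.wf (r := fun v u : FreeMonoid X => DegLex v u)
    (fun h => degLex_of_elwStep hlt h)
    (InvImage.wf FreeMonoid.toList (List.Shortlex.wf wellFounded_lt))

theorem exists_isReduced [WellFoundedLT X]
    (hlt : ∀ u v, rels u v → DegLex v u) (u : FreeMonoid X) :
    ∃ v, Relation.ReflTransGen (ELWStep (relPolys k rels)) u v ∧
      IsReduced (relPolys k rels) v := by
  induction u using (wellFounded_elwStep (k := k) hlt).induction with
  | _ u ih =>
    by_cases h : IsReduced (relPolys k rels) u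
    · exact ⟨u, .refl, h⟩
    · rw [isReduced_relPolys_iff hlt] at h
      push Not at h
      obtain ⟨p, q, a, b, hpq, rfl⟩ := h
      have hs : ELWStep (relPolys k rels) (a * p * b) (a * q * b) :=
        (elwStep_relPolys_iff hlt).2 ⟨p, q, a, b, hpq, rfl, rfl⟩
      obtain ⟨v, hv, hr⟩ := ih _ hs
      exact ⟨v, .head hs hv, hr⟩

theorem map_eq_of_reflTransGen {M : Type*} [Monoid M] {φ : FreeMonoid X →* M}
    (hlt : ∀ u v, rels u v → DegLex v u)
    (hφ : ∀ u v, rels u v → φ u = φ v) {u v : FreeMonoid X}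
    (h : Relation.ReflTransGen (ELWStep (relPolys k rels)) u v) : φ u = φ v := by
  induction h with
  | refl => rfl
  | tail _ h ih =>
    obtain ⟨p, q, a, b, hpq, rfl, rfl⟩ := (elwStep_relPolys_iff hlt).1 h
    rw [ih]
    simp only [map_mul, hφ _ _ hpq]

theorem eq_or_degLex_of_reflTransGen
    (hlt : ∀ u v, rels u v → DegLex v u) {u v : FreeMonoid X}
    (h : Relation.ReflTransGen (ELWStep (relPolys k rels)) u v) : v = u ∨ DegLex v u := by
  induction h with
  | refl => exact .inl rfl
  | tail _ h ih =>
    have := degLex_of_elwStep hlt h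
    rcases ih with rfl | ih
    · exact .inr this
    · exact .inr (this.trans ih)

/-- Each elimination contributes one `a t b`, whose leading word is the word being rewritten. These
words only decrease, so they all stay below `w`. -/
theorem isTrivialMod_of_reflTransGen
    (hlt : ∀ u v, rels u v → DegLex v u) {u v w : FreeMonoid X}
    (h : Relation.ReflTransGen (ELWStep (relPolys k rels)) u v) (hu : DegLex u w) :
    IsTrivialMod (relPolys k rels) w (word k u - word k v) := by
  induction h using Relation.ReflTransGen.head_induction_on with
  | refl =>
    rw [sub_self]
    exact zero_mem _
  | @head u u' h _ ih =>
    have hd := degLex_of_elwStep hlt h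
    rw [← sub_add_sub_cancel _ (word k u')]
    refine add_mem (Submodule.subset_span ?_) (ih (hd.trans hu))
    obtain ⟨p, q, a, b, hpq, rfl, rfl⟩ := (elwStep_relPolys_iff hlt).1 h
    exact ⟨_, ⟨p, q, hpq, rfl⟩, a, b, (mul_sub_mul_word a p q b).symm, _, isLeadingWord_sub hd, hu⟩

/-- If the relations hold in a monoid where distinct reduced words have distinct images, then their
polynomials form a Gröbner–Shirshov basis. -/
theorem isGSBasis_relPolys [WellFoundedLT X] {M : Type*} [Monoid M] {φ : FreeMonoid X →* M}
    (hlt : ∀ u v, rels u v → DegLex v u)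
    (hφ : ∀ u v, rels u v → φ u = φ v)
    (huniq : ∀ u v, IsReduced (relPolys k rels) u → IsReduced (relPolys k rels) v →
      φ u = φ v → u = v) : IsGSBasis (relPolys k rels) := by
  have key : ∀ u v w : FreeMonoid X, φ u = φ v → DegLex u w → DegLex v w →
      IsTrivialMod (relPolys k rels) w (word k u - word k v) := by
    intro u v w e hu hv
    obtain ⟨u', hu', hur⟩ := exists_isReduced (k := k) hlt u
    obtain ⟨v', hv', hvr⟩ := exists_isReduced (k := k) hlt v
    obtain rfl : u' = v' := huniq _ _ hur hvr (by
      rw [← map_eq_of_reflTransGen hlt hφ hu', e, map_eq_of_reflTransGen hlt hφ hv'])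
    rw [← sub_sub_sub_cancel_right _ _ (word k u')]
    exact sub_mem (isTrivialMod_of_reflTransGen hlt hu' hu)
      (isTrivialMod_of_reflTransGen hlt hv' hv)
  refine ⟨?_, ?_⟩
  · rintro _ ⟨u, v, h, rfl⟩
    exact ⟨u, isLeadingWord_sub (hlt _ _ h), coeff_word_sub_word_self (hlt _ _ h)⟩
  · rintro _ ⟨u, v, h, rfl⟩ _ ⟨u', v', h', rfl⟩ w p hp
    cases hp with
    | intersection lf lg a b hf hg hw hdeg =>
      obtain rfl := hf.unique (isLeadingWord_sub (hlt _ _ h))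
      obtain rfl := hg.unique (isLeadingWord_sub (hlt _ _ h'))
      -- The two copies of the ambiguity cancel.
      have e : (word k lf - word k v) * word k b - word k a * (word k lg - word k v') =
          word k (a * v') - word k (v * b) := by
        rw [sub_mul, mul_sub, ← word_mul, ← word_mul, ← word_mul, ← word_mul, hw]
        abel
      rw [e]
      refine key _ _ _ ?_ ?_ ?_
      · rw [map_mul, ← hφ _ _ h', map_mul, ← hφ _ _ h, ← map_mul, ← map_mul, hw]
      · rw [hw]
        simpa using (hlt _ _ h').mul a 1
      · simpa using (hlt _ _ h).mul 1 b
    | including lf lg a b hf hg hw =>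
      obtain rfl := hf.unique (isLeadingWord_sub (hlt _ _ h))
      obtain rfl := hg.unique (isLeadingWord_sub (hlt _ _ h'))
      rw [mul_sub_mul_word, ← hw, sub_sub_sub_cancel_left]
      refine key _ _ _ ?_ ?_ (hlt _ _ h)
      · rw [← hφ _ _ h, hw]
        simp only [map_mul, hφ _ _ h']
      · rw [hw]
        exact (hlt _ _ h').mul a b

end Rels

end DegLex

/-! ### Equality in the monoid and the ideal of the relations -/

/-- The difference of two words with equal images in the presented monoid lies in the ideal
of the relations. -/
theorem word_sub_word_mem_span {rels : FreeMonoid X → FreeMonoid X → Prop} {u v : FreeMonoid X}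
    (h : PresentedMonoid.mk rels u = PresentedMonoid.mk rels v) :
    word k u - word k v ∈ TwoSidedIdeal.span (relPolys k rels) := by
  replace h : ConGen.Rel rels u v := PresentedMonoid.mk_eq_mk_iff.1 h
  induction h with
  | of u v h => exact TwoSidedIdeal.subset_span ⟨u, v, h, rfl⟩
  | refl u =>
    rw [sub_self]
    exact TwoSidedIdeal.zero_mem _
  | symm h ih =>
    rw [← neg_sub]
    exact TwoSidedIdeal.neg_mem _ ih
  | trans h h' ih ih' =>
    rw [← sub_add_sub_cancel]
    exact TwoSidedIdeal.add_mem _ ih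
      ih'
  | @mul u u' v v' h h' ih ih' =>
    have e : word k (u * v) - word k (u' * v') =
        (word k u - word k u') * word k v + word k u' * (word k v - word k v') := by
      simp only [word_mul, mul_sub, sub_mul, sub_add_sub_cancel]
    rw [e]
    exact TwoSidedIdeal.add_mem _
      (TwoSidedIdeal.mul_mem_right _ _ _ ih)
      (TwoSidedIdeal.mul_mem_left _ _ _ ih')

end GSBasis

namespace BraidSemigroup

open GSBasis

variable {n : ℕ}

/-! ### From finitely many strands to infinitely many -/

theorem indices_eq_map (u : FreeMonoid (Fin n)) :
    indices u = u.toList.map fun x : Fin n => (x : ℕ) + 1 := by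
  unfold indices
  -- The coercion to `ℕ` in `indices` passes through the list monad; it is turned back into `map`.
  simp only [List.bind_eq_flatMap, List.pure_def, ← List.map_eq_flatMap, List.map_map]
  rfl

theorem indices_mul (u v : FreeMonoid (Fin n)) : indices (u * v) = indices u ++ indices v := by
  simp only [indices_eq_map, FreeMonoid.toList_mul, List.map_append]

theorem indices_injective : Function.Injective (indices : FreeMonoid (Fin n) → List ℕ) := by
  intro u v h
  rw [indices_eq_map, indices_eq_map] at h
  exact FreeMonoid.toList.injective
    (List.map_injective_iff.2 (fun x y h => Fin.ext (Nat.succ_injective h)) h)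

theorem length_indices (u : FreeMonoid (Fin n)) : (indices u).length = u.toList.length := by
  rw [indices_eq_map, List.length_map]

theorem mem_indices {u : FreeMonoid (Fin n)} {x : ℕ} (h : x ∈ indices u) : 1 ≤ x ∧ x ≤ n := by
  rw [indices_eq_map] at h
  obtain ⟨y, -, rfl⟩ := List.mem_map.1 h
  omega

theorem exists_indices_eq {l : List ℕ} (h : ∀ x ∈ l, 1 ≤ x ∧ x ≤ n) :
    ∃ u : FreeMonoid (Fin n), indices u = l := by
  induction l with
  | nil => exact ⟨1, rfl⟩
  | cons x l ih =>
    rw [List.forall_mem_cons] at h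
    obtain ⟨u, rfl⟩ := ih h.2
    refine ⟨.of ⟨x - 1, by omega⟩ * u, ?_⟩
    rw [indices_mul]
    change [x - 1 + 1] ++ _ = _
    rw [Nat.sub_add_cancel h.1.1]
    rfl

theorem exists_indices_eq_append {u : FreeMonoid (Fin n)} {l r : List ℕ}
    (h : indices u = l ++ r) : ∃ a b, u = a * b ∧ indices a = l ∧ indices b = r := by
  obtain ⟨a, rfl⟩ := exists_indices_eq (n := n) (l := l)
    fun x hx => mem_indices (h ▸ List.mem_append_left r hx)
  obtain ⟨b, rfl⟩ := exists_indices_eq (n := n) (l := r)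
    fun x hx => mem_indices (h ▸ List.mem_append_right _ hx)
  exact ⟨a, b, indices_injective (by rw [h, indices_mul]), rfl, rfl⟩

/-- This keeps derivations that start in a finite alphabet inside it. -/
theorem mem_of_artinRel {l r : List ℕ} (h : ArtinRel l r) (x : ℕ) : x ∈ l ↔ x ∈ r := by
  cases h <;> simp only [List.mem_cons, List.not_mem_nil, or_false] <;> tauto

theorem el_eq_of_mk_eq {u v : FreeMonoid (Fin n)}
    (h : PresentedMonoid.mk (artinRels n) u = PresentedMonoid.mk (artinRels n) v) :
    el (indices u) = el (indices v) := by
  replace h : ConGen.Rel (artinRels n) u v := PresentedMonoid.mk_eq_mk_iff.1 h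
  induction h with
  | of u v h => exact el_eq_of_rel h
  | refl u => rfl
  | symm _ ih => exact ih.symm
  | trans _ _ ih ih' => exact ih.trans ih'
  | mul _ _ ih ih' => rw [indices_mul, indices_mul, el_append, el_append, ih, ih']

/-- A derivation over `ℕ` from a word over `Fin n` lifts to `Fin n` step by step. Both directions
are carried together so that the symmetry rule only swaps them. -/
theorem exists_mk_eq_of_rel {l r : FreeMonoid ℕ} (h : ConGen.Rel natRels l r) :
    (∀ u : FreeMonoid (Fin n), indices u = l.toList → ∃ v, indices v = r.toList ∧
      PresentedMonoid.mk (artinRels n) u = PresentedMonoid.mk (artinRels n) v) ∧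
    (∀ u : FreeMonoid (Fin n), indices u = r.toList → ∃ v, indices v = l.toList ∧
      PresentedMonoid.mk (artinRels n) u = PresentedMonoid.mk (artinRels n) v) := by
  induction h with
  | of l r h =>
    constructor
    · intro u hu
      obtain ⟨v, hv⟩ := exists_indices_eq (n := n) (l := r.toList)
        fun x hx => mem_indices (hu ▸ (mem_of_artinRel h x).2 hx)
      refine ⟨v, hv, PresentedMonoid.mk_eq_mk_of_rel ?_⟩
      rw [artinRels, hu, hv]
      exact h
    · intro u hu
      obtain ⟨v, hv⟩ := exists_indices_eq (n := n) (l := l.toList)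
        fun x hx => mem_indices (hu ▸ (mem_of_artinRel h x).1 hx)
      refine ⟨v, hv, (PresentedMonoid.mk_eq_mk_of_rel ?_).symm⟩
      rw [artinRels, hu, hv]
      exact h
  | refl l => exact ⟨fun u hu => ⟨u, hu, rfl⟩, fun u hu => ⟨u, hu, rfl⟩⟩
  | symm _ ih => exact ih.symm
  | trans _ _ ih ih' =>
    constructor
    · intro u hu
      obtain ⟨v, hv, e⟩ := ih.1 u hu
      obtain ⟨w, hw, e'⟩ := ih'.1 v hv
      exact ⟨w, hw, e.trans e'⟩
    · intro u hu
      obtain ⟨v, hv, e⟩ := ih'.2 u hu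
      obtain ⟨w, hw, e'⟩ := ih.2 v hv
      exact ⟨w, hw, e.trans e'⟩
  | mul _ _ ih ih' =>
    constructor
    · intro u hu
      rw [FreeMonoid.toList_mul] at hu
      obtain ⟨a, b, rfl, ha, hb⟩ := exists_indices_eq_append hu
      obtain ⟨a', ha', e⟩ := ih.1 a ha
      obtain ⟨b', hb', e'⟩ := ih'.1 b hb
      exact ⟨a' * b', by rw [indices_mul, ha', hb', FreeMonoid.toList_mul],
        by rw [map_mul, map_mul, e, e']⟩
    · intro u hu
      rw [FreeMonoid.toList_mul] at hu
      obtain ⟨a, b, rfl, ha, hb⟩ := exists_indices_eq_append hu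
      obtain ⟨a', ha', e⟩ := ih.2 a ha
      obtain ⟨b', hb', e'⟩ := ih'.2 b hb
      exact ⟨a' * b', by rw [indices_mul, ha', hb', FreeMonoid.toList_mul],
        by rw [map_mul, map_mul, e, e']⟩

theorem mk_eq_mk_iff_el {u v : FreeMonoid (Fin n)} :
    PresentedMonoid.mk (artinRels n) u = PresentedMonoid.mk (artinRels n) v ↔
      el (indices u) = el (indices v) := by
  refine ⟨el_eq_of_mk_eq, fun h => ?_⟩
  obtain ⟨w, hw, e⟩ := (exists_mk_eq_of_rel (PresentedMonoid.mk_eq_mk_iff.1 h)).1 u rfl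
  rwa [indices_injective hw] at e

theorem length_eq_of_mk_eq {u v : FreeMonoid (Fin n)}
    (h : PresentedMonoid.mk (artinRels n) u = PresentedMonoid.mk (artinRels n) v) :
    u.toList.length = v.toList.length := by
  rw [← length_indices, ← len_el, el_eq_of_mk_eq h, len_el, length_indices]

theorem mk_eq_of_basisRels {u v : FreeMonoid (Fin n)} (h : basisRels n u v) :
    PresentedMonoid.mk (artinRels n) u = PresentedMonoid.mk (artinRels n) v :=
  mk_eq_mk_iff_el.2 (el_eq_of_basisRel h)

/-! ### The basis over the finite alphabet -/

theorem BasisRel.exists_cons {p q : List ℕ} (h : BasisRel p q) :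
    ∃ x y s t, p = x :: s ∧ q = y :: t ∧ y < x := by
  cases h with
  | chain i j V W => exact ⟨i + 1, i, _, _, rfl, rfl, Nat.lt_succ_self i⟩
  | comm s k h => exact ⟨s, k, _, _, rfl, rfl, by omega⟩

theorem degLex_of_basisRels {u v : FreeMonoid (Fin n)} (h : basisRels n u v) : DegLex v u := by
  have hlen := length_eq_of_mk_eq (mk_eq_of_basisRels h)
  refine List.Shortlex.of_lex hlen.symm ?_
  obtain ⟨x, y, s, t, hu, hv, hxy⟩ := h.exists_cons
  rw [indices_eq_map] at hu hv
  obtain ⟨x', s', hu', rfl, -⟩ := List.map_eq_cons_iff.1 hu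
  obtain ⟨y', t', hv', rfl, -⟩ := List.map_eq_cons_iff.1 hv
  rw [hu', hv']
  exact .rel (Fin.lt_def.2 (by omega))

/-- Raising the indices of `W` is harmless: they stay at most `i + 1`, a letter of the left side.
Hence reducedness means the same over `Fin n` and over `ℕ`. -/
theorem BasisRel.mem_le {p q : List ℕ} (h : BasisRel p q) (hp : ∀ x ∈ p, 1 ≤ x ∧ x ≤ n) :
    ∀ x ∈ q, 1 ≤ x ∧ x ≤ n := by
  cases h with
  | comm s k h =>
    intro x hx
    simp only [List.mem_cons, List.not_mem_nil, or_false] at hx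
    exact hp x (by simp only [List.mem_cons, List.not_mem_nil, or_false]; tauto)
  | chain i j V W hi hj hji hV hW hW' =>
    have hn := (hp (i + 1) (by simp)).2
    intro x hx
    simp only [List.mem_append, List.mem_cons, List.not_mem_nil, or_false, mem_desc,
      List.mem_map] at hx
    rcases hx with ((hx | hx) | hx) | ⟨y, hy, rfl⟩
    · omega
    · have := hV x hx
      omega
    · omega
    · have := hW y hy
      omega

theorem isReduced_basis_iff {k : Type*} [Field k] {u : FreeMonoid (Fin n)} :
    IsReduced (basis k n) u ↔ Reduced (indices u) := by
  rw [basis, isReduced_relPolys_iff fun _ _ => degLex_of_basisRels]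
  constructor
  · intro h a b p q hpq hu
    obtain ⟨v, b, rfl, hv, rfl⟩ := exists_indices_eq_append hu
    obtain ⟨a, p, rfl, rfl, rfl⟩ := exists_indices_eq_append hv
    obtain ⟨q, rfl⟩ := exists_indices_eq (hpq.mem_le fun x => mem_indices)
    exact h p q a b hpq rfl
  · rintro h p q a b hpq rfl
    exact h (indices a) (indices b) _ _ hpq (by rw [indices_mul, indices_mul])

theorem eq_of_isReduced_basis {k : Type*} [Field k] {u v : FreeMonoid (Fin n)}
    (hu : IsReduced (basis k n) u) (hv : IsReduced (basis k n) v)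
    (h : PresentedMonoid.mk (artinRels n) u = PresentedMonoid.mk (artinRels n) v) : u = v :=
  indices_injective ((isReduced_basis_iff.1 hu).eq_of_el_eq (isReduced_basis_iff.1 hv)
    (fun _ hx => (mem_indices hx).1) (fun _ hx => (mem_indices hx).1) (el_eq_of_mk_eq h))

theorem basisRels_of_artinRels {u v : FreeMonoid (Fin n)} (h : artinRels n u v) :
    basisRels n u v := by
  unfold artinRels at h
  unfold basisRels
  have hu : ∀ x ∈ indices u, 1 ≤ x := fun x hx => (mem_indices hx).1
  generalize indices u = p at *
  generalize indices v = q at *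
  cases h with
  | comm i j h => exact .comm i j h
  | braid i =>
    -- For `j = i + 1` and empty `V`, `W` the chain relation is the braid relation.
    have := BasisRel.chain i (i + 1) [] [] (hu i (by simp)) (by omega) le_rfl (by simp) (by simp)
      (by simp)
    rwa [desc_succ le_rfl, desc_eq_nil (Nat.lt_succ_self i)] at this

theorem isGSBasisOf_basis (k : Type*) [Field k] : IsGSBasisOf (basis k n) (artinRels n) := by
  refine ⟨isGSBasis_relPolys (fun _ _ => degLex_of_basisRels)
    (φ := PresentedMonoid.mk (artinRels n)) (fun _ _ => mk_eq_of_basisRels)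
    fun u v => eq_of_isReduced_basis, le_antisymm ?_ ?_⟩
  · rw [TwoSidedIdeal.span_le]
    rintro _ ⟨u, v, h, rfl⟩
    exact word_sub_word_mem_span (mk_eq_of_basisRels h)
  · apply TwoSidedIdeal.span_mono
    rintro _ ⟨u, v, h, rfl⟩
    exact ⟨u, v, basisRels_of_artinRels h, rfl⟩

end BraidSemigroup

/-! ### Computing the equivalence class of a word -/

namespace WordRewriting

variable {α : Type*}

section Saturate

variable {β : Type*}

/-- Add to a list all neighbours of its members. -/
def saturate (nb : β → List β) (L : List β) : List β := L ++ L.flatMap nb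

theorem mem_saturate {nb : β → List β} {L : List β} {v : β} :
    v ∈ saturate nb L ↔ v ∈ L ∨ ∃ w ∈ L, v ∈ nb w := by
  rw [saturate, List.mem_append, List.mem_flatMap]

/-- An iterate that is not closed gains a member at the next step, so the `k`-th one is closed or
has more than `k` members; the latter is impossible for `k = T.card`. -/
theorem saturate_closed [DecidableEq β] {nb : β → List β} {u : β} {T : Finset β}
    (hT : ∀ k, ∀ v ∈ (saturate nb)^[k] [u], v ∈ T) :
    ∀ v ∈ (saturate nb)^[T.card] [u], ∀ w ∈ nb v, w ∈ (saturate nb)^[T.card] [u] := by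
  have key : ∀ k, k + 1 ≤ ((saturate nb)^[k] [u]).toFinset.card ∨
      ∀ v ∈ (saturate nb)^[k] [u], ∀ w ∈ nb v, w ∈ (saturate nb)^[k] [u] := by
    intro k
    induction k with
    | zero => simp
    | succ k ih =>
      rw [Function.iterate_succ_apply']
      by_cases hc : ∀ v ∈ (saturate nb)^[k] [u], ∀ w ∈ nb v, w ∈ (saturate nb)^[k] [u]
      · right
        intro v hv w hw
        rw [mem_saturate] at hv ⊢
        left
        rcases hv with hv | ⟨v', hv', hv⟩
        · exact hc v hv w hw
        · exact hc v (hc v' hv' v hv) w hw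
      · left
        have := ih.resolve_right hc
        push Not at hc
        obtain ⟨v, hv, w, hw, hn⟩ := hc
        refine lt_of_le_of_lt this (Finset.card_lt_card ?_)
        rw [Finset.ssubset_iff_of_subset]
        · exact ⟨w, List.mem_toFinset.2 (mem_saturate.2 (.inr ⟨v, hv, hw⟩)),
            fun h => hn (List.mem_toFinset.1 h)⟩
        · intro x hx
          rw [List.mem_toFinset] at hx ⊢
          exact mem_saturate.2 (.inl hx)
  refine (key T.card).resolve_left fun h => ?_
  have : ((saturate nb)^[T.card] [u]).toFinset ⊆ T := fun v hv =>
    hT _ v (List.mem_toFinset.1 hv)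
  have := Finset.card_le_card this
  omega

end Saturate

variable [DecidableEq α]

/-- Replace an occurrence of the first word at position `i` by the second one. -/
def replaceAt (pq : List α × List α) (i : ℕ) (l : List α) : List α :=
  if (l.drop i).take pq.1.length = pq.1 then l.take i ++ (pq.2 ++ l.drop (i + pq.1.length)) else l

/-- The words obtained by one replacement. -/
def neighbours (R : List (List α × List α)) (l : List α) : List (List α) :=
  (List.range (l.length + 1)).flatMap fun i => R.map fun pq => replaceAt pq i l

theorem append_mem_neighbours {R : List (List α × List α)} {p q : List α} (h : (p, q) ∈ R)
    (a b : List α) : a ++ q ++ b ∈ neighbours R (a ++ p ++ b) := by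
  refine List.mem_flatMap.2 ⟨a.length, ?_, List.mem_map.2 ⟨(p, q), h, ?_⟩⟩
  · simp only [List.mem_range, List.length_append]
    omega
  · have h1 : (a ++ p ++ b).drop a.length = p ++ b := by
      rw [List.append_assoc, List.drop_left]
    have h2 : (a ++ p ++ b).drop (a.length + p.length) = b := by
      rw [← List.length_append, List.drop_left]
    have h3 : (a ++ p ++ b).take a.length = a := by
      rw [List.append_assoc, List.take_left]
    rw [replaceAt, h1, h2, h3, List.take_left, if_pos rfl, List.append_assoc]

theorem exists_of_mem_neighbours {R : List (List α × List α)} {l r : List α}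
    (h : r ∈ neighbours R l) :
    r = l ∨ ∃ a b p q, (p, q) ∈ R ∧ l = a ++ p ++ b ∧ r = a ++ q ++ b := by
  obtain ⟨i, -, h⟩ := List.mem_flatMap.1 h
  obtain ⟨⟨p, q⟩, hpq, rfl⟩ := List.mem_map.1 h
  unfold replaceAt
  split_ifs with hc
  · refine .inr ⟨l.take i, l.drop (i + p.length), p, q, hpq, ?_, by rw [List.append_assoc]⟩
    conv_lhs => rw [← List.take_append_drop i l, ← List.take_append_drop p.length (l.drop i)]
    rw [hc, List.drop_drop, List.append_assoc]
  · exact .inl rfl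

/-! ### Least words, compared by their base `n` values -/

/-- The value of a word over `Fin n` as a number in base `n`, after the leading part `a`. -/
def value {n : ℕ} (a : ℕ) (l : List (Fin n)) : ℕ := l.foldl (fun s (x : Fin n) => s * n + x) a

theorem value_lt_value {n : ℕ} {a b : ℕ} (h : a < b) {s t : List (Fin n)}
    (hlen : s.length = t.length) : value a s < value b t := by
  induction s generalizing a b t with
  | nil =>
    obtain rfl := List.length_eq_zero_iff.1 hlen.symm
    exact h
  | cons x s ih =>
    obtain _ | ⟨y, t⟩ := t
    · simp at hlen
    · refine ih (?_ : a * n + x < b * n + y) (Nat.succ.inj hlen)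
      have := x.isLt
      calc a * n + x < (a + 1) * n := by rw [add_mul, one_mul]; omega
        _ ≤ b * n := Nat.mul_le_mul_right n h
        _ ≤ b * n + y := Nat.le_add_right _ _

theorem value_lt_value_of_lex {n : ℕ} {s t : List (Fin n)} (h : List.Lex (· < ·) s t)
    (hlen : s.length = t.length) (a : ℕ) : value a s < value a t := by
  induction h generalizing a with
  | nil => simp at hlen
  | rel h => exact value_lt_value (Nat.add_lt_add_left h _) (by simpa using hlen)
  | cons _ ih => exact ih (by simpa using hlen) _

/-- A member of `l :: L` of least value. -/
def leastWord {n : ℕ} (L : List (List (Fin n))) (l : List (Fin n)) : List (Fin n) :=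
  L.foldl (fun m w => if value 0 w < value 0 m then w else m) l

theorem leastWord_mem {n : ℕ} (L : List (List (Fin n))) (l : List (Fin n)) :
    leastWord L l = l ∨ leastWord L l ∈ L := by
  induction L generalizing l with
  | nil => exact .inl rfl
  | cons w L ih =>
    change leastWord L _ = l ∨ leastWord L _ ∈ w :: L
    rcases ih (if value 0 w < value 0 l then w else l) with h | h
    · rw [h]
      split_ifs
      · exact .inr (by simp)
      · exact .inl rfl
    · exact .inr (List.mem_cons_of_mem _ h)

theorem value_leastWord_le {n : ℕ} (L : List (List (Fin n))) (l : List (Fin n)) :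
    value 0 (leastWord L l) ≤ value 0 l ∧ ∀ w ∈ L, value 0 (leastWord L l) ≤ value 0 w := by
  induction L generalizing l with
  | nil => exact ⟨le_rfl, by simp⟩
  | cons w L ih =>
    have e : leastWord (w :: L) l = leastWord L (if value 0 w < value 0 l then w else l) := rfl
    rw [e]
    obtain ⟨h1, h2⟩ := ih (if value 0 w < value 0 l then w else l)
    rw [List.forall_mem_cons]
    split_ifs at h1 h2 ⊢ with hc
    · exact ⟨h1.trans hc.le, h1, h2⟩
    · exact ⟨h1, h1.trans (not_lt.1 hc), h2⟩

/-- The words equivalent to a word, for length-preserving relations. -/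
def classList {n : ℕ} (R : List (List (Fin n) × List (Fin n))) (l : List (Fin n)) :
    List (List (Fin n)) :=
  (saturate (neighbours R))^[n ^ l.length] [l]

/-! ### Primitive recursiveness -/

section Primrec

variable {n : ℕ}

theorem primrec_value : Primrec fun l : List (Fin n) => value 0 l :=
  Primrec.list_foldl Primrec.id (Primrec.const 0)
    ((Primrec.nat_add.comp
      (Primrec.nat_mul.comp (Primrec.fst.comp Primrec.snd) (Primrec.const n))
      (Primrec.fin_val.comp (Primrec.snd.comp Primrec.snd))).to₂)

theorem primrec_pow_length : Primrec fun l : List (Fin n) => n ^ l.length := by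
  have : Primrec fun l : List (Fin n) => (fun s => s * n)^[l.length] 1 :=
    Primrec.nat_iterate Primrec.list_length (Primrec.const 1)
      ((Primrec.nat_mul.comp Primrec.snd (Primrec.const n)).to₂)
  refine this.of_eq fun l => ?_
  rw [mul_right_iterate]
  exact one_mul _

theorem primrec_leastWord : Primrec₂ (leastWord (n := n)) := by
  refine Primrec.list_foldl (h := fun _ x => if value 0 x.2 < value 0 x.1 then x.2 else x.1)
    Primrec.fst Primrec.snd ?_
  refine Primrec.ite ?_ (Primrec.snd.comp Primrec.snd) (Primrec.fst.comp Primrec.snd)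
  exact Primrec.nat_lt.comp (primrec_value.comp (Primrec.snd.comp Primrec.snd))
    (primrec_value.comp (Primrec.fst.comp Primrec.snd))

theorem primrec_replaceAt : Primrec fun x : (List (Fin n) × List (Fin n)) × ℕ × List (Fin n) =>
    replaceAt x.1 x.2.1 x.2.2 := by
  have p : Primrec fun x : (List (Fin n) × List (Fin n)) × ℕ × List (Fin n) => x.1.1 :=
    Primrec.fst.comp Primrec.fst
  have i : Primrec fun x : (List (Fin n) × List (Fin n)) × ℕ × List (Fin n) => x.2.1 :=
    Primrec.fst.comp Primrec.snd
  have l : Primrec fun x : (List (Fin n) × List (Fin n)) × ℕ × List (Fin n) => x.2.2 :=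
    Primrec.snd.comp Primrec.snd
  have pl := Primrec.list_length.comp p
  refine Primrec.ite ?_ ?_ l
  · exact Primrec.eq.comp (Primrec.list_take.comp pl (Primrec.list_drop.comp i l)) p
  · exact Primrec.list_append.comp (Primrec.list_take.comp i l)
      (Primrec.list_append.comp (Primrec.snd.comp Primrec.fst)
        (Primrec.list_drop.comp (Primrec.nat_add.comp i pl) l))

theorem primrec_neighbours (R : List (List (Fin n) × List (Fin n))) :
    Primrec (neighbours R) := by
  refine Primrec.list_flatMap
    (Primrec.list_range.comp (Primrec.succ.comp Primrec.list_length)) ?_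
  refine Primrec.list_map (g := fun (x : List (Fin n) × ℕ) pq => replaceAt pq x.2 x.1) (Primrec.const R) ?_
  exact primrec_replaceAt.comp (Primrec.pair Primrec.snd
    (Primrec.pair (Primrec.snd.comp Primrec.fst) (Primrec.fst.comp Primrec.fst)))

theorem primrec_classList (R : List (List (Fin n) × List (Fin n))) : Primrec (classList R) := by
  refine Primrec.nat_iterate primrec_pow_length
    (Primrec.list_cons.comp Primrec.id (Primrec.const [])) ?_
  exact Primrec.list_append.comp Primrec.snd
    (Primrec.list_flatMap Primrec.snd ((primrec_neighbours R).comp Primrec.snd).to₂)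

theorem primrec_leastWord_classList (R : List (List (Fin n) × List (Fin n))) :
    Primrec fun l => leastWord (classList R l) l :=
  primrec_leastWord.comp (primrec_classList R) Primrec.id

end Primrec

end WordRewriting

namespace BraidSemigroup

open GSBasis WordRewriting

variable {n : ℕ}

/-! ### The normal form as the least word of a finite class -/

/-- The defining relations and their inverses are finite in number. -/
theorem exists_list_artinRels (n : ℕ) : ∃ R : List (List (Fin n) × List (Fin n)), ∀ p q,
    (p, q) ∈ R ↔ artinRels n (.ofList p) (.ofList q) ∨ artinRels n (.ofList q) (.ofList p) := by
  have hlen : ∀ p q : List (Fin n), artinRels n (.ofList p) (.ofList q) →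
      p.length ≤ 3 ∧ q.length ≤ 3 := by
    intro p q h
    have hp : (indices (.ofList p)).length = p.length := length_indices _
    have hq : (indices (.ofList q)).length = q.length := length_indices _
    rw [← hp, ← hq]
    unfold artinRels at h
    generalize indices (.ofList p) = l at *
    generalize indices (.ofList q) = r at *
    cases h <;> simp
  have hfin : {x : List (Fin n) × List (Fin n) | artinRels n (.ofList x.1) (.ofList x.2) ∨
      artinRels n (.ofList x.2) (.ofList x.1)}.Finite := by
    refine ((List.finite_length_le (Fin n) 3).prod (List.finite_length_le (Fin n) 3)).subset ?_
    rintro ⟨p, q⟩ (h | h)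
    · exact hlen p q h
    · exact (hlen q p h).symm
  exact ⟨hfin.toFinset.toList, fun p q => by simp⟩

section Class

variable {R : List (List (Fin n) × List (Fin n))}

theorem mk_eq_of_mem_iterate
    (hR : ∀ p q, (p, q) ∈ R ↔
      artinRels n (.ofList p) (.ofList q) ∨ artinRels n (.ofList q) (.ofList p))
    {l : List (Fin n)} (k : ℕ) :
    ∀ r ∈ (saturate (neighbours R))^[k] [l], PresentedMonoid.mk (artinRels n) (.ofList r) =
      PresentedMonoid.mk (artinRels n) (.ofList l) := by
  induction k with
  | zero => simp
  | succ k ih =>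
    intro r hr
    rw [Function.iterate_succ_apply', mem_saturate] at hr
    rcases hr with hr | ⟨s, hs, hr⟩
    · exact ih r hr
    · rw [← ih s hs]
      rcases exists_of_mem_neighbours hr with rfl | ⟨a, b, p, q, hpq, rfl, rfl⟩
      · rfl
      · have : PresentedMonoid.mk (artinRels n) (.ofList q) =
            PresentedMonoid.mk (artinRels n) (.ofList p) := by
          rcases (hR p q).1 hpq with h | h
          · exact (PresentedMonoid.mk_eq_mk_of_rel h).symm
          · exact PresentedMonoid.mk_eq_mk_of_rel h
        simp only [FreeMonoid.ofList_append, map_mul, this]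

/-- The contexts `a`, `b` let the induction pass through products: the factors are replaced one
after the other, each with the other one absorbed into its context. -/
theorem mem_iff_mem_of_closed
    (hR : ∀ p q, (p, q) ∈ R ↔
      artinRels n (.ofList p) (.ofList q) ∨ artinRels n (.ofList q) (.ofList p))
    {A : List (List (Fin n))}
    (hA : ∀ l ∈ A, ∀ r ∈ neighbours R l, r ∈ A) {u v : FreeMonoid (Fin n)}
    (h : ConGen.Rel (artinRels n) u v) :
    ∀ a b : FreeMonoid (Fin n), (a * u * b).toList ∈ A ↔ (a * v * b).toList ∈ A := by
  induction h with
  | of u v h =>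
    intro a b
    simp only [FreeMonoid.toList_mul]
    exact ⟨fun h' => hA _ h' _ (append_mem_neighbours ((hR _ _).2 (.inl h)) _ _),
      fun h' => hA _ h' _ (append_mem_neighbours ((hR _ _).2 (.inr h)) _ _)⟩
  | refl u => exact fun a b => Iff.rfl
  | symm _ ih => exact fun a b => (ih a b).symm
  | trans _ _ ih ih' => exact fun a b => (ih a b).trans (ih' a b)
  | @mul u u' v v' _ _ ih ih' =>
    intro a b
    have h1 := ih a (v * b)
    have h2 := ih' (a * u') b
    simp only [mul_assoc] at h1 h2 ⊢
    exact h1.trans h2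

theorem mem_classList_iff
    (hR : ∀ p q, (p, q) ∈ R ↔
      artinRels n (.ofList p) (.ofList q) ∨ artinRels n (.ofList q) (.ofList p))
    {l r : List (Fin n)} : r ∈ classList R l ↔
    PresentedMonoid.mk (artinRels n) (.ofList r) =
      PresentedMonoid.mk (artinRels n) (.ofList l) := by
  refine ⟨mk_eq_of_mem_iterate hR _ r, fun h => ?_⟩
  -- All words of the length of `l`: they contain the class, and their number is the iteration count
  -- of `classList`.
  let T : Finset (List (Fin n)) :=
    Finset.univ.map ⟨(List.Vector.toList : List.Vector (Fin n) l.length → List (Fin n)),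
      List.Vector.toList_injective⟩
  have hcard : T.card = n ^ l.length := by
    rw [Finset.card_map, Finset.card_univ, card_vector, Fintype.card_fin]
  have hclosed := saturate_closed (nb := neighbours R) (u := l) (T := T) (by
    intro k v hv
    have hv := length_eq_of_mk_eq (mk_eq_of_mem_iterate hR k v hv)
    exact Finset.mem_map.2 ⟨⟨v, hv⟩, Finset.mem_univ _, rfl⟩)
  rw [hcard] at hclosed
  have := mem_iff_mem_of_closed hR hclosed (PresentedMonoid.mk_eq_mk_iff.1 h) 1 1
  simp only [one_mul, mul_one] at this
  refine this.2 ?_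
  have : ∀ k, l ∈ (saturate (neighbours R))^[k] [l] := by
    intro k
    induction k with
    | zero => simp
    | succ k ih =>
      rw [Function.iterate_succ_apply']
      exact mem_saturate.2 (.inl ih)
  exact this _

/-- The least word of the class of a word is its normal form. -/
theorem isReduced_leastWord
    (hR : ∀ p q, (p, q) ∈ R ↔
      artinRels n (.ofList p) (.ofList q) ∨ artinRels n (.ofList q) (.ofList p))
    (k : Type*) [Field k] (l : List (Fin n)) :
    IsReduced (basis k n) (.ofList (leastWord (classList R l) l)) ∧
      Relation.ReflTransGen (ELWStep (basis k n)) (.ofList l)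
        (.ofList (leastWord (classList R l) l)) := by
  set m := leastWord (classList R l) l with hm
  have hml : PresentedMonoid.mk (artinRels n) (.ofList m) =
      PresentedMonoid.mk (artinRels n) (.ofList l) := by
    rcases leastWord_mem (classList R l) l with h | h
    · rw [hm, h]
    · exact (mem_classList_iff hR).1 h
  have hlt : ∀ u v, basisRels n u v → DegLex v u := fun _ _ => degLex_of_basisRels
  have hφ : ∀ u v, basisRels n u v → PresentedMonoid.mk (artinRels n) u =
    PresentedMonoid.mk (artinRels n) v := fun _ _ => mk_eq_of_basisRels
  obtain ⟨v, hlv, hv⟩ := exists_isReduced (k := k) hlt (.ofList l)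
  obtain ⟨w, hmw, hw⟩ := exists_isReduced (k := k) hlt (.ofList m)
  have hlv' := map_eq_of_reflTransGen hlt hφ hlv
  have hmw' := map_eq_of_reflTransGen hlt hφ hmw
  obtain rfl : v = w := eq_of_isReduced_basis hv hw (hlv'.symm.trans (hml.symm.trans hmw'))
  -- If eliminations changed `m`, they would lead to a smaller word of the same class and length,
  -- against the minimality of its value.
  rcases eq_or_degLex_of_reflTransGen hlt hmw with rfl | hd
  · exact ⟨hv, hlv⟩
  · have hle := (value_leastWord_le (classList R l) l).2 v.toList
      ((mem_classList_iff hR).2 hlv'.symm)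
    have hlen := length_eq_of_mk_eq hmw'
    rcases List.shortlex_def.1 hd with h | ⟨-, h⟩
    · omega
    · exact absurd (value_lt_value_of_lex h hlen.symm 0) (not_lt.2 hle)

end Class

end BraidSemigroup

/-- The two families form a Gröbner–Shirshov basis of `B⁺_{n+1}`; every element of `B⁺_{n+1}` is
represented by exactly one reduced word; eliminations of leading words always terminate and compute
this normal form, which is a computable function of the word and decides the word problem. -/
theorem theorem1 (n : ℕ) (k : Type*) [Field k] :
    GSBasis.IsGSBasisOf (BraidSemigroup.basis k n) (BraidSemigroup.artinRels n) ∧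
    (∀ b : BraidSemigroup.BraidMonoid n, ∃! u : FreeMonoid (Fin n),
      GSBasis.IsReduced (BraidSemigroup.basis k n) u ∧
        PresentedMonoid.mk (BraidSemigroup.artinRels n) u = b) ∧
    WellFounded (fun v u : FreeMonoid (Fin n) =>
      GSBasis.ELWStep (BraidSemigroup.basis k n) u v) ∧
    (∃ nf : List (Fin n) → List (Fin n), Computable nf ∧
      (∀ u : List (Fin n),
        GSBasis.IsReduced (BraidSemigroup.basis k n) (FreeMonoid.ofList (nf u)) ∧
        Relation.ReflTransGen (GSBasis.ELWStep (BraidSemigroup.basis k n))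
          (FreeMonoid.ofList u) (FreeMonoid.ofList (nf u))) ∧
      ∀ u v : List (Fin n),
        PresentedMonoid.mk (BraidSemigroup.artinRels n) (FreeMonoid.ofList u) =
          PresentedMonoid.mk (BraidSemigroup.artinRels n) (FreeMonoid.ofList v) ↔
        nf u = nf v) ∧
    ComputablePred (fun p : List (Fin n) × List (Fin n) =>
      PresentedMonoid.mk (BraidSemigroup.artinRels n) (FreeMonoid.ofList p.1) =
        PresentedMonoid.mk (BraidSemigroup.artinRels n) (FreeMonoid.ofList p.2)) := by
  -- The list `R` is only known to exist, but it is a constant for fixed `n`, so computability is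
  -- not affected.
  obtain ⟨R, hR⟩ := BraidSemigroup.exists_list_artinRels n
  have hlt : ∀ u v, BraidSemigroup.basisRels n u v → GSBasis.DegLex v u :=
    fun _ _ => BraidSemigroup.degLex_of_basisRels
  have hφ : ∀ u v, BraidSemigroup.basisRels n u v →
      PresentedMonoid.mk (BraidSemigroup.artinRels n) u =
        PresentedMonoid.mk (BraidSemigroup.artinRels n) v :=
    fun _ _ => BraidSemigroup.mk_eq_of_basisRels
  have hnf := BraidSemigroup.isReduced_leastWord hR k
  have hprim := WordRewriting.primrec_leastWord_classList R
  have hiff : ∀ u v : List (Fin n),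
      PresentedMonoid.mk (BraidSemigroup.artinRels n) (FreeMonoid.ofList u) =
        PresentedMonoid.mk (BraidSemigroup.artinRels n) (FreeMonoid.ofList v) ↔
      WordRewriting.leastWord (WordRewriting.classList R u) u =
        WordRewriting.leastWord (WordRewriting.classList R v) v := by
    intro u v
    have hu := GSBasis.map_eq_of_reflTransGen hlt hφ (hnf u).2
    have hv := GSBasis.map_eq_of_reflTransGen hlt hφ (hnf v).2
    rw [hu, hv]
    exact ⟨fun h => FreeMonoid.ofList.injective
      (BraidSemigroup.eq_of_isReduced_basis (hnf u).1 (hnf v).1 h), fun h => by rw [h]⟩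
  refine ⟨BraidSemigroup.isGSBasisOf_basis k, fun b => ?_, GSBasis.wellFounded_elwStep hlt,
    ⟨_, hprim.to_comp, hnf, hiff⟩, ?_⟩
  · obtain ⟨u, rfl⟩ := PresentedMonoid.surjective_mk b
    obtain ⟨v, huv, hv⟩ := GSBasis.exists_isReduced (k := k) hlt u
    have e := GSBasis.map_eq_of_reflTransGen hlt hφ huv
    exact ⟨v, ⟨hv, e.symm⟩, fun w hw =>
      BraidSemigroup.eq_of_isReduced_basis hw.1 hv (hw.2.trans e)⟩
  · have h : PrimrecPred fun p : List (Fin n) × List (Fin n) =>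
        WordRewriting.leastWord (WordRewriting.classList R p.1) p.1 =
          WordRewriting.leastWord (WordRewriting.classList R p.2) p.2 :=
      Primrec.eq.comp (hprim.comp Primrec.fst) (hprim.comp Primrec.snd)
    exact h.computablePred.of_eq fun p => (hiff p.1 p.2).symm
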